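/- Let $\mathbb H=L^2((0,1);\mathbb R)$ with norm $\|\cdot\|$, and let $E=\mathcal C([0,1];\mathbb R)$ with norm $\|x\|_E=\max_{\xi\in[0,1]}|x(\xi)|$. For $k\in\mathbb N=\{1,2,\ldots\}$ set $\lambda_k=k^2\pi^2$ and $e_k=\sqrt2\,\sin(k\pi\,\cdot)$, and for $t\ge 0$ and $x\in\mathbb H$ let $S(t)x=\sum_{k\in\mathbb N}e^{-\lambda_k t}\langle x,e_k\rangle e_k$ (the heat semigroup on $(0,1)$ with homogeneous Dirichlet boundary conditions). Let $H\in(1/4,1/2)\cup(1/2,1)$, and let $(\beta_k^H)_{k\in\mathbb N}$ be independent real-valued fractional Brownian motions with Hurst index $H$ on a probability space $(\Omega,\mathcal F,\mathbb P)$, i.e. centred Gaussian processes indexed by $t\ge 0$ with $\mathbb E[\beta_k^H(t)\beta_k^H(s)]=\frac12\bigl(t^{2H}+s^{2H}-|t-s|^{2H}\bigr)$. For $\Delta t\in(0,1)$ and integers $n\ge 0$ put $t_n=n\Delta t$ and define the discrete fractional Ornstein--Uhlenbeck process $$Z_n^H=\sum_{j=0}^{n-1}S(t_n-t_j)\,\Delta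 B_j^H,\qquad S(t_n-t_j)\,\Delta B_j^H:=\sum_{k\in\mathbb N}\bigl(\beta_k^H(t_{j+1})-\beta_k^H(t_j)\bigr)S(t_n-t_j)e_k .$$ Then for all $\Delta t\in(0,1)$ and all $n\ge 0$, almost surely $Z_n^H\in\mathbb H$ (the series defining it converge in $\mathbb H$) and $Z_n^H\in E$ (it has a representative that is continuous on $[0,1]$), and $Z_n^H$ is a random variable with values in $\mathbb H$ and, through its continuous representative, in $E$. Moreover, for all $p\in\mathbb N$, $$\sup_{\Delta t\in(0,1)}\ \sup_{n\ge 0}\ \bigl(\mathbb E[\|Z_n^H\|^p]\bigr)^{1/p}+\sup_{\Delta t\in(0,1)}\ \sup_{n\ge 0}\ \bigl(\mathbb E[\|Z_n^H\|_E^p]\bigr)^{1/p}<\infty .$$ -/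

import Mathlib

open MeasureTheory ProbabilityTheory Set
open scoped NNReal ENNReal

namespace FracOU

/-- The Hilbert space `L²((0,1); ℝ)`. -/
abbrev L2I : Type := Lp ℝ 2 (volume.restrict (Ioo (0 : ℝ) 1))

/-- The Banach space `C([0,1]; ℝ)` with the maximum norm. -/
abbrev E : Type := C(Icc (0 : ℝ) 1, ℝ)

/-- The eigenvalues `k² π²`, `k = 1, 2, …`; the index is shifted, so `eigval k` is
`(k+1)² π²` for `k = 0, 1, …`. -/
noncomputable def eigval (k : ℕ) : ℝ := ((k : ℝ) + 1) ^ 2 * Real.pi ^ 2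

/-- The eigenfunctions `ξ ↦ √2 sin(k π ξ)`, with the same index shift as `eigval`. -/
noncomputable def eigfun (k : ℕ) (ξ : ℝ) : ℝ :=
  Real.sqrt 2 * Real.sin (((k : ℝ) + 1) * Real.pi * ξ)

lemma memLp_eigfun (k : ℕ) : MemLp (eigfun k) 2 (volume.restrict (Ioo (0 : ℝ) 1)) := by
  refine MemLp.of_bound (C := Real.sqrt 2) ?_ (Filter.Eventually.of_forall fun ξ => ?_)
  · exact Continuous.aestronglyMeasurable (by unfold eigfun; fun_prop)
  · rw [eigfun, norm_mul, Real.norm_of_nonneg (Real.sqrt_nonneg 2)]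
    exact mul_le_of_le_one_right (Real.sqrt_nonneg 2) (Real.abs_sin_le_one _)

/-- The eigenfunctions as elements of `L²((0,1); ℝ)`. -/
noncomputable def eigvec (k : ℕ) : L2I := (memLp_eigfun k).toLp (eigfun k)

/-- The heat semigroup with homogeneous Dirichlet boundary conditions,
`S(t) x = ∑ₖ exp(-λₖ t) ⟨x, eₖ⟩ eₖ`. -/
noncomputable def semigroup (t : ℝ) (x : L2I) : L2I :=
  ∑' k : ℕ, (Real.exp (-eigval k * t) * inner ℝ x (eigvec k)) • eigvec k

/-- A real-valued fractional Brownian motion with Hurst index `H`: a centred Gaussian process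
with covariance `(t^{2H} + s^{2H} - |t-s|^{2H}) / 2`. -/
structure IsFractionalBrownianMotion {Ω : Type*} [MeasurableSpace Ω] (H : ℝ)
    (X : ℝ≥0 → Ω → ℝ) (P : Measure Ω) : Prop where
  measurable : ∀ t, Measurable (X t)
  gaussian : IsGaussianProcess X P
  mean : ∀ t, ∫ ω, X t ω ∂P = 0
  cov : ∀ t s, ∫ ω, X t ω * X s ω ∂P =
    ((t : ℝ) ^ (2 * H) + (s : ℝ) ^ (2 * H) - |(t : ℝ) - (s : ℝ)| ^ (2 * H)) / 2

/-- The increment `β_k(t_{j+1}) - β_k(t_j)` over the grid `t_j = j Δt`. -/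
def increment {Ω : Type*} (β : ℕ → ℝ≥0 → Ω → ℝ) (Δt : ℝ≥0) (k j : ℕ) (ω : Ω) : ℝ :=
  β k (((j + 1 : ℕ) : ℝ≥0) * Δt) ω - β k ((j : ℝ≥0) * Δt) ω

/-- The `k`-th term of the series for `S(t) ΔB_j`, where `ΔB_j = ∑ₖ (β_k(t_{j+1}) - β_k(t_j)) eₖ`
is a (formal) increment of the cylindrical process `B = ∑ₖ β_k eₖ`. -/
noncomputable def noiseTerm {Ω : Type*} (β : ℕ → ℝ≥0 → Ω → ℝ) (Δt : ℝ≥0) (t : ℝ) (j : ℕ)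
    (ω : Ω) (k : ℕ) : L2I :=
  increment β Δt k j ω • semigroup t (eigvec k)

/-- The discrete process `Z_n = ∑_{j<n} S(t_n - t_j) ΔB_j`, for the grid `t_j = j Δt`. Where one
of the series for `S(t_n - t_j) ΔB_j` diverges this is a junk value; see `DefinedInL2`. -/
noncomputable def Z {Ω : Type*} (β : ℕ → ℝ≥0 → Ω → ℝ) (Δt : ℝ≥0) (n : ℕ) (ω : Ω) : L2I :=
  ∑ j ∈ Finset.range n,
    ∑' k : ℕ, noiseTerm β Δt ((n : ℝ) * (Δt : ℝ) - (j : ℝ) * (Δt : ℝ)) j ω k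

/-- `Z_n(ω)` is a well-defined element of `L²(0,1)`: every series `S(t_n - t_j) ΔB_j(ω)`, `j < n`,
converges in `L²(0,1)`. -/
def DefinedInL2 {Ω : Type*} (β : ℕ → ℝ≥0 → Ω → ℝ) (Δt : ℝ≥0) (n : ℕ) (ω : Ω) : Prop :=
  ∀ j < n, Summable (noiseTerm β Δt ((n : ℝ) * (Δt : ℝ) - (j : ℝ) * (Δt : ℝ)) j ω)

/-- The continuous function `f` on `[0,1]` represents the class `x` in `L²(0,1)`. -/
def Represents (f : E) (x : L2I) : Prop :=
  (x : ℝ → ℝ) =ᵐ[volume.restrict (Ioo (0 : ℝ) 1)] IccExtend zero_le_one f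

/-- The class `x` in `L²(0,1)` belongs to `C([0,1])`, i.e. has a representative that is continuous
on `[0,1]`. -/
def InE (x : L2I) : Prop := ∃ f : E, Represents f x

open Classical in
/-- The (unique) continuous representative of `x`, as an element of `C([0,1])`; `0` if there is
none. -/
noncomputable def toE (x : L2I) : E := if h : InE x then h.choose else 0

end FracOU

open FracOU

/-! Expand `Z_n` in the sine basis. Its coefficients are independent in `k`, and the core of the
proof is that the `k`-th one is sub-Gaussian with parameter at most `25 k^(-4H)` (`k ≥ 1`),
uniformly in `n` and `Δt`. Summation by parts in time (`coefZ_eq`) turns it into a weighted sum of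
displacements `β_k(t_{n-m}) - β_k(t_n)`, of standard deviation `(m Δt)^H`. Minkowski's inequality,
which ignores correlations in time and so treats all `H` alike, then bounds the square root of the
parameter by `5 λ_k^(-H)`.

Since `4H > 1`, such a sine series has all moments in the maximum norm. Cut it into dyadic frequency
blocks. At a fixed point, independence makes block `m` sub-Gaussian with parameter of order
`2^(m(1-4H))`; the maximum over `[0,1]` reduces to a grid of `8^m + 1` points plus a Lipschitz
error. A moment of high enough order `2r` beats the number of points (`integral_norm_block_pow_le`),
and the block norms in `L^(2r)` sum geometrically (`eLpNorm_tsum_eigC_le`).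

Convergence is easy: only times `t_n - t_j ≥ Δt > 0` occur, so the heat factor makes each series
converge absolutely in `C([0,1])` almost surely. Thus `Z_n` is the image of a continuous function,
and its `L²` norm is at most the maximum norm. -/

namespace FracOU

/-! ### Moments of sub-Gaussian variables. -/

section SubGaussian

variable {Ω : Type*} [MeasurableSpace Ω] {P : Measure Ω}

lemma hasSubgaussianMGF_const_mul {X : Ω → ℝ} {c : ℝ≥0} (h : HasSubgaussianMGF X c P) (a : ℝ) :
    HasSubgaussianMGF (fun ω => a * X ω) (‖a‖₊ ^ 2 * c) P where
  integrable_exp_mul t := by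
    simpa only [mul_assoc] using h.integrable_exp_mul (t * a)
  mgf_le t := by
    rw [mgf_const_mul]
    refine (h.mgf_le _).trans_eq ?_
    congr 1
    push_cast
    rw [Real.norm_eq_abs, sq_abs]
    ring

/-- Minkowski's inequality for sub-Gaussian parameters. -/
lemma hasSubgaussianMGF_sum_mul [IsProbabilityMeasure P] {ι : Type*} (s : Finset ι)
    (a : ι → ℝ) (c : ι → ℝ≥0) (X : ι → Ω → ℝ)
    (h : ∀ i ∈ s, HasSubgaussianMGF (X i) (c i ^ 2) P) :
    HasSubgaussianMGF (fun ω => ∑ i ∈ s, a i * X i ω) ((∑ i ∈ s, ‖a i‖₊ * c i) ^ 2) P := by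
  classical
  induction s using Finset.induction_on with
  | empty => simp
  | insert i s hi ih =>
    have h1 : HasSubgaussianMGF (fun ω => a i * X i ω) ((‖a i‖₊ * c i) ^ 2) P := by
      rw [mul_pow]
      exact hasSubgaussianMGF_const_mul (h i (Finset.mem_insert_self i s)) (a i)
    have h3 := h1.add (ih fun j hj => h j (Finset.mem_insert_of_mem hj))
    rw [NNReal.sqrt_sq, NNReal.sqrt_sq] at h3
    simpa only [Finset.sum_insert hi] using h3

/-- The constant in the bound for the moment of order `2 r` of a sub-Gaussian variable. -/
noncomputable def momentConst (r : ℕ) : ℝ := (2 * r).factorial * (2 * Real.exp (1 / 2))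

lemma momentConst_nonneg (r : ℕ) : 0 ≤ momentConst r := by
  unfold momentConst; positivity

lemma integrable_pow_of_hasSubgaussianMGF {X : Ω → ℝ} {c : ℝ≥0} (h : HasSubgaussianMGF X c P)
    (r : ℕ) : Integrable (fun ω => X ω ^ (2 * r)) P := by
  have h1 := (h.memLp ((2 * r : ℕ) : ℝ≥0))
  rw [ENNReal.coe_natCast] at h1
  rcases Nat.eq_zero_or_pos r with rfl | hr
  · simpa using h.integrable_exp_mul 0
  refine (h1.integrable_norm_pow (by omega)).congr (Filter.Eventually.of_forall fun ω => ?_)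
  simp [pow_mul]

/-- Use `y^(2r) / (2r)! ≤ e^y + e^(-y)` at `y = X / √v`; each exponential moment is then at most
`e^(1/2)`. A separate `v ≥ c` permits this scaling even when `c = 0`. -/
lemma integral_pow_le_of_hasSubgaussianMGF {X : Ω → ℝ} {c : ℝ≥0}
    (h : HasSubgaussianMGF X c P) {v : ℝ} (hv : 0 < v) (hc : (c : ℝ) ≤ v) (r : ℕ) :
    ∫ ω, X ω ^ (2 * r) ∂P ≤ momentConst r * v ^ r := by
  set t : ℝ := (Real.sqrt v)⁻¹ with ht
  have ht2 : t ^ 2 = v⁻¹ := by rw [ht, inv_pow, Real.sq_sqrt hv.le]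
  have key : ∀ x : ℝ, x ^ (2 * r) ≤
      (2 * r).factorial * v ^ r * (Real.exp (t * x) + Real.exp (-t * x)) := by
    intro x
    have h1 := Real.pow_div_factorial_le_exp |t * x| (abs_nonneg _) (2 * r)
    have h2 : Real.exp |t * x| ≤ Real.exp (t * x) + Real.exp (-t * x) := by
      rcases abs_cases (t * x) with ⟨e, -⟩ | ⟨e, -⟩ <;> rw [e]
      · linarith [Real.exp_pos (-t * x)]
      · rw [← neg_mul]; linarith [Real.exp_pos (t * x)]
    have h3 : |t * x| ^ (2 * r) = (v ^ r)⁻¹ * x ^ (2 * r) := by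
      rw [pow_mul, sq_abs, mul_pow, mul_pow, ht2, inv_pow, pow_mul]
    rw [h3, div_le_iff₀ (by positivity)] at h1
    have h4 : x ^ (2 * r) = v ^ r * ((v ^ r)⁻¹ * x ^ (2 * r)) := by
      field_simp
    rw [h4]
    calc _ ≤ v ^ r * (Real.exp |t * x| * (2 * r).factorial) := by gcongr
      _ ≤ v ^ r * ((Real.exp (t * x) + Real.exp (-t * x)) * (2 * r).factorial) := by gcongr
      _ = _ := by ring
  have hm : ∀ u : ℝ, u ^ 2 = v⁻¹ → ∫ ω, Real.exp (u * X ω) ∂P ≤ Real.exp (1 / 2) := by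
    intro u hu
    refine (h.mgf_le u).trans (Real.exp_le_exp.2 ?_)
    rw [hu]
    have : (c : ℝ) * v⁻¹ ≤ 1 := by rw [← div_eq_mul_inv]; exact (div_le_one hv).2 hc
    linarith
  calc ∫ ω, X ω ^ (2 * r) ∂P
      ≤ ∫ ω, (2 * r).factorial * v ^ r * (Real.exp (t * X ω) + Real.exp (-t * X ω)) ∂P :=
        integral_mono (integrable_pow_of_hasSubgaussianMGF h r)
          (((h.integrable_exp_mul t).add (h.integrable_exp_mul (-t))).const_mul _)
          fun ω => key (X ω)
    _ = (2 * r).factorial * v ^ r *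
          (∫ ω, Real.exp (t * X ω) ∂P + ∫ ω, Real.exp (-t * X ω) ∂P) := by
        rw [integral_const_mul, integral_add (h.integrable_exp_mul t) (h.integrable_exp_mul (-t))]
    _ ≤ (2 * r).factorial * v ^ r * (Real.exp (1 / 2) + Real.exp (1 / 2)) := by
        gcongr
        · exact hm t ht2
        · exact hm (-t) (by rw [neg_sq, ht2])
    _ = momentConst r * v ^ r := by unfold momentConst; ring

/-- A centred Gaussian variable is sub-Gaussian with its variance as parameter. -/
lemma hasSubgaussianMGF_of_hasGaussianLaw {X : Ω → ℝ} (h : HasGaussianLaw X P)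
    (hX : ∫ ω, X ω ∂P = 0) {c : ℝ≥0} (hc : ∫ ω, X ω ^ 2 ∂P = c) :
    HasSubgaussianMGF X c P := by
  have hv : variance X P = c := by
    rw [variance_of_integral_eq_zero h.aemeasurable hX, ← hc]
  have hmap := h.map_eq_gaussianReal
  rw [hX, hv, Real.toNNReal_coe] at hmap
  rw [← HasSubgaussianMGF.id_map_iff h.aemeasurable, hmap]
  exact ⟨integrable_exp_mul_gaussianReal, fun t => by rw [mgf_id_gaussianReal]; simp⟩

end SubGaussian

/-! ### Sine polynomials and their maximum over a grid. -/

section SineSeries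

/-- The eigenfunctions as elements of `C([0,1])`. -/
noncomputable def eigC (k : ℕ) : E :=
  ⟨fun ξ => eigfun k ξ, by unfold eigfun; fun_prop⟩

lemma eigC_apply (k : ℕ) (ξ : Icc (0 : ℝ) 1) : eigC k ξ = eigfun k ξ := rfl

lemma abs_eigfun_le (k : ℕ) (ξ : ℝ) : |eigfun k ξ| ≤ Real.sqrt 2 := by
  rw [eigfun, abs_mul, abs_of_nonneg (Real.sqrt_nonneg 2)]
  exact mul_le_of_le_one_right (Real.sqrt_nonneg 2) (Real.abs_sin_le_one _)

lemma norm_eigC_le (k : ℕ) : ‖eigC k‖ ≤ Real.sqrt 2 :=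
  (ContinuousMap.norm_le _ (Real.sqrt_nonneg 2)).2 fun ξ => abs_eigfun_le k ξ

lemma abs_eigfun_sub_le (k : ℕ) (ξ η : ℝ) :
    |eigfun k ξ - eigfun k η| ≤ 5 * ((k : ℝ) + 1) * |ξ - η| := by
  have h1 : Real.sqrt 2 * Real.pi ≤ 5 := by
    have h2 : Real.sqrt 2 ≤ 1.42 := by
      rw [Real.sqrt_le_left (by norm_num)]; norm_num
    have := Real.pi_lt_d2
    have := Real.pi_pos
    nlinarith [Real.sqrt_nonneg 2]
  have h2 := Real.abs_sin_sub_sin_le (((k : ℝ) + 1) * Real.pi * ξ) (((k : ℝ) + 1) * Real.pi * η)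
  rw [← mul_sub, abs_mul,
    abs_of_nonneg (by positivity : 0 ≤ ((k : ℝ) + 1) * Real.pi)] at h2
  rw [eigfun, eigfun, ← mul_sub, abs_mul, abs_of_nonneg (Real.sqrt_nonneg 2)]
  calc _ ≤ Real.sqrt 2 * (((k : ℝ) + 1) * Real.pi * |ξ - η|) := by gcongr
    _ = Real.sqrt 2 * Real.pi * (((k : ℝ) + 1) * |ξ - η|) := by ring
    _ ≤ 5 * (((k : ℝ) + 1) * |ξ - η|) := by gcongr
    _ = _ := by ring

/-- The maximum of a sine polynomial is controlled by its values on a grid and its coefficients. -/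
lemma norm_sum_eigC_pow_le (s : Finset ℕ) (x : ℕ → ℝ) {M : ℕ} (hM : 0 < M) (q : ℕ) :
    ‖∑ k ∈ s, x k • eigC k‖ ^ (2 * q) ≤ 2 ^ (2 * q) *
      (∑ i ∈ Finset.range (M + 1), (∑ k ∈ s, eigfun k ((i : ℝ) / M) * x k) ^ (2 * q) +
        (∑ k ∈ s, |x k| * (5 * ((k : ℝ) + 1) / M)) ^ (2 * q)) := by
  set f : E := ∑ k ∈ s, x k • eigC k with hf
  set g : ℝ → ℝ := fun ξ => ∑ k ∈ s, eigfun k ξ * x k with hg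
  have hfg : ∀ ξ : Icc (0 : ℝ) 1, f ξ = g ξ := fun ξ => by
    simp [hf, hg, ContinuousMap.sum_apply, eigC_apply, mul_comm]
  obtain ⟨ξ, -, hξ⟩ := isCompact_univ.exists_isMaxOn (univ_nonempty (α := Icc (0 : ℝ) 1))
    (f := fun ξ => ‖f ξ‖) (by fun_prop)
  have hnorm : ‖f‖ ≤ |g ξ| := by
    rw [← hfg]
    exact (ContinuousMap.norm_le _ (abs_nonneg _)).2 fun η => hξ (mem_univ η)
  have hM' : (0 : ℝ) < M := by exact_mod_cast hM
  -- `i / M` is the grid point just left of the maximiser `ξ`; `ξ = 1` gives `i = M`, hence `M + 1`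
  -- points.
  set i : ℕ := ⌊(ξ : ℝ) * M⌋₊ with hi
  have hξ0 : 0 ≤ (ξ : ℝ) := ξ.2.1
  have hi1 : (i : ℝ) ≤ (ξ : ℝ) * M := Nat.floor_le (by positivity)
  have hi2 : (ξ : ℝ) * M < (i : ℝ) + 1 := Nat.lt_floor_add_one _
  have hdist : |(ξ : ℝ) - i / M| ≤ 1 / M := by
    have e : (ξ : ℝ) - i / M = ((ξ : ℝ) * M - i) / M := by field_simp
    rw [e, abs_div, abs_of_pos hM', abs_of_nonneg (by linarith)]
    gcongr; linarith
  have himem : i ∈ Finset.range (M + 1) := by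
    rw [Finset.mem_range, Nat.lt_succ_iff]
    have : (i : ℝ) ≤ M := hi1.trans (mul_le_of_le_one_left hM'.le ξ.2.2)
    exact_mod_cast this
  have hlip : |g ξ - g (i / M)| ≤ ∑ k ∈ s, |x k| * (5 * ((k : ℝ) + 1) / M) := by
    rw [hg, ← Finset.sum_sub_distrib]
    refine (Finset.abs_sum_le_sum_abs _ _).trans (Finset.sum_le_sum fun k _ => ?_)
    rw [← sub_mul, abs_mul, mul_comm]
    refine mul_le_mul_of_nonneg_left ?_ (abs_nonneg _)
    refine (abs_eigfun_sub_le k _ _).trans ?_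
    rw [div_eq_mul_one_div (5 * ((k : ℝ) + 1)) (M : ℝ)]
    exact mul_le_mul_of_nonneg_left hdist (by positivity)
  set A := ∑ k ∈ s, |x k| * (5 * ((k : ℝ) + 1) / M)
  have hA : 0 ≤ A := (abs_nonneg _).trans hlip
  have h1 : ‖f‖ ≤ |g (i / M)| + A := by
    have := abs_sub_abs_le_abs_sub (g ξ) (g (i / M))
    linarith
  calc ‖f‖ ^ (2 * q) ≤ (|g (i / M)| + A) ^ (2 * q) := by gcongr
    _ ≤ 2 ^ (2 * q - 1) * (|g (i / M)| ^ (2 * q) + A ^ (2 * q)) :=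
        add_pow_le (abs_nonneg _) hA _
    _ ≤ 2 ^ (2 * q) * (|g (i / M)| ^ (2 * q) + A ^ (2 * q)) := by
        gcongr
        · norm_num
        · omega
    _ ≤ _ := by
        gcongr
        rw [pow_mul, sq_abs, ← pow_mul]
        exact Finset.single_le_sum (f := fun i : ℕ => g ((i : ℝ) / M) ^ (2 * q))
          (fun j _ => by rw [pow_mul]; positivity) himem

end SineSeries

/-! ### Moments of one dyadic block in the maximum norm. -/

section Blocks

variable {Ω : Type*} [MeasurableSpace Ω] {P : Measure Ω}

/-- The indices of the frequencies in `[2 ^ m, 2 ^ (m + 1))`. -/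
def dyadicBlock (m : ℕ) : Finset ℕ := Finset.Ico (2 ^ m - 1) (2 ^ (m + 1) - 1)

lemma card_dyadicBlock (m : ℕ) : (dyadicBlock m).card = 2 ^ m := by
  rw [dyadicBlock, Nat.card_Ico, pow_succ]
  have := Nat.one_le_two_pow (n := m)
  omega

lemma le_of_mem_dyadicBlock {m k : ℕ} (h : k ∈ dyadicBlock m) :
    (2 : ℝ) ^ m ≤ (k : ℝ) + 1 ∧ (k : ℝ) + 1 ≤ 2 * 2 ^ m := by
  rw [dyadicBlock, Finset.mem_Ico, pow_succ] at h
  have := Nat.one_le_two_pow (n := m)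
  constructor
  · exact_mod_cast (by omega : 2 ^ m ≤ k + 1)
  · exact_mod_cast (by omega : k + 1 ≤ 2 * 2 ^ m)

/-- The constant in the moment bound for dyadic blocks. -/
noncomputable def blockConst (K : ℝ) (r : ℕ) : ℝ :=
  2 ^ (2 * r) * (2 * momentConst r * (2 * K) ^ r + 10 ^ (2 * r) * momentConst r * K ^ r)

/-- The grid has mesh `8^(-m)`. Its `8^m + 1` points contribute at most `16^(-m)` each, up to
constants, which leaves `2^(-m)`. Frequencies are at most `2 · 2^m`, so the Lipschitz error is at
most `10 · 4^(-m) ∑ |X k|`, small enough for a crude power-mean bound. -/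
lemma integral_norm_block_pow_le {K α : ℝ} (hK : 0 < K) {r : ℕ} (hr : 1 ≤ r)
    (hα : 4 ≤ (α - 1) * r) {X : ℕ → Ω → ℝ} (hX : iIndepFun X P) {c : ℕ → ℝ≥0}
    (hc : ∀ k, HasSubgaussianMGF (X k) (c k) P)
    (hcK : ∀ k, (c k : ℝ) ≤ K * ((k : ℝ) + 1) ^ (-α)) (m : ℕ) :
    Integrable (fun ω => ‖∑ k ∈ dyadicBlock m, X k ω • eigC k‖ ^ (2 * r)) P ∧
    ∫ ω, ‖∑ k ∈ dyadicBlock m, X k ω • eigC k‖ ^ (2 * r) ∂P ≤ blockConst K r * (1 / 2) ^ m := by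
  have hr0 : (0 : ℝ) < r := by exact_mod_cast hr
  have hα1 : 1 < α := by
    by_contra h
    nlinarith
  set s := dyadicBlock m
  have hcs : ∀ k ∈ s, (c k : ℝ) ≤ K * ((2 : ℝ) ^ m) ^ (-α) := fun k hk =>
    (hcK k).trans (mul_le_mul_of_nonneg_left
      (Real.rpow_le_rpow_of_nonpos (by positivity) (le_of_mem_dyadicBlock hk).1 (by linarith)) hK.le)
  set v : ℝ := 2 * K * ((2 : ℝ) ^ m) ^ (1 - α) with hv
  have hv0 : 0 < v := by positivity
  -- This is where `4 ≤ (α - 1) r` enters: `2^(m(1-α)r) ≤ 2^(-4m)`.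
  have hvr : v ^ r ≤ (2 * K) ^ r * (1 / 16) ^ m := by
    rw [hv, mul_pow]
    gcongr
    rw [← Real.rpow_natCast, ← Real.rpow_mul (by positivity), ← Real.rpow_natCast 2 m,
      ← Real.rpow_mul (by norm_num), one_div, inv_pow, ← Real.rpow_natCast 16 m,
      ← Real.rpow_neg (by norm_num), (by norm_num : (16 : ℝ) = 2 ^ (4 : ℝ)),
      ← Real.rpow_mul (by norm_num)]
    refine Real.rpow_le_rpow_of_exponent_le (by norm_num) ?_
    have : (0 : ℝ) ≤ m := by positivity
    nlinarith
  set G : ℕ → Ω → ℝ := fun i ω => ∑ k ∈ s, eigfun k ((i : ℝ) / (8 ^ m : ℕ)) * X k ω with hG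
  have hGsub : ∀ i, ∃ d : ℝ≥0, HasSubgaussianMGF (G i) d P ∧ (d : ℝ) ≤ v := by
    intro i
    -- Independence lets the parameters add, giving `2^m` terms of size `2K · 2^(-mα)`; Minkowski
    -- would lose another factor `2^m`.
    have hind : iIndepFun (fun k ω => eigfun k ((i : ℝ) / (8 ^ m : ℕ)) * X k ω) P :=
      hX.comp (fun k x => eigfun k ((i : ℝ) / (8 ^ m : ℕ)) * x) fun k => by fun_prop
    refine ⟨_, HasSubgaussianMGF.sum_of_iIndepFun hind (s := s)
      fun k _ => hasSubgaussianMGF_const_mul (hc k) _, ?_⟩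
    rw [NNReal.coe_sum]
    calc _ ≤ ∑ k ∈ s, 2 * (K * ((2 : ℝ) ^ m) ^ (-α)) := by
          refine Finset.sum_le_sum fun k hk => ?_
          rw [NNReal.coe_mul, NNReal.coe_pow, coe_nnnorm, Real.norm_eq_abs]
          gcongr
          · calc |eigfun k ((i : ℝ) / (8 ^ m : ℕ))| ^ 2 ≤ Real.sqrt 2 ^ 2 := by
                  gcongr; exact abs_eigfun_le _ _
              _ = 2 := Real.sq_sqrt (by norm_num)
          · exact hcs k hk
      _ = v := by
          rw [Finset.sum_const, card_dyadicBlock, nsmul_eq_mul, hv, sub_eq_add_neg,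
            Real.rpow_add (by positivity), Real.rpow_one]
          push_cast
          ring
  choose d hd hdv using hGsub
  have hcK' : ∀ k, (c k : ℝ) ≤ K := fun k => (hcK k).trans (mul_le_of_le_one_right hK.le
    (Real.rpow_le_one_of_one_le_of_nonpos (by linarith [(Nat.cast_nonneg k : (0 : ℝ) ≤ k)])
      (by linarith)))
  set R : Ω → ℝ := fun ω => 2 ^ (2 * r) * (∑ i ∈ Finset.range (8 ^ m + 1), G i ω ^ (2 * r) +
    (10 / 4 ^ m) ^ (2 * r) * ((2 ^ m) ^ (2 * r - 1) * ∑ k ∈ s, X k ω ^ (2 * r))) with hR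
  have hle : ∀ ω, ‖∑ k ∈ s, X k ω • eigC k‖ ^ (2 * r) ≤ R ω := by
    intro ω
    refine (norm_sum_eigC_pow_le s (fun k => X k ω) (M := 8 ^ m) (by positivity) r).trans ?_
    rw [hR]
    dsimp only
    gcongr _ * (_ + ?_)
    have h1 : ∑ k ∈ s, |X k ω| * (5 * ((k : ℝ) + 1) / (8 ^ m : ℕ)) ≤
        10 / 4 ^ m * ∑ k ∈ s, |X k ω| := by
      rw [Finset.mul_sum]
      refine Finset.sum_le_sum fun k hk => ?_
      rw [mul_comm]
      refine mul_le_mul_of_nonneg_right ?_ (abs_nonneg _)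
      rw [div_le_div_iff₀ (by positivity) (by positivity)]
      push_cast
      calc 5 * ((k : ℝ) + 1) * 4 ^ m ≤ 5 * (2 * 2 ^ m) * 4 ^ m := by
            gcongr; exact (le_of_mem_dyadicBlock hk).2
        _ = 10 * 8 ^ m := by
            rw [(by norm_num : (8 : ℝ) = 2 * 4), mul_pow]; ring
    have h2 := pow_sum_div_card_le_sum_pow (s := s) (f := fun k => |X k ω|)
      (fun k _ => abs_nonneg _) (2 * r - 1)
    rw [card_dyadicBlock, div_le_iff₀ (by positivity), Nat.sub_add_cancel (by omega)] at h2
    calc _ ≤ (10 / 4 ^ m * ∑ k ∈ s, |X k ω|) ^ (2 * r) := by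
          gcongr
      _ = (10 / 4 ^ m) ^ (2 * r) * (∑ k ∈ s, |X k ω|) ^ (2 * r) := by rw [mul_pow]
      _ ≤ (10 / 4 ^ m) ^ (2 * r) * ((∑ k ∈ s, |X k ω| ^ (2 * r)) * (2 ^ m : ℕ) ^ (2 * r - 1)) := by
          gcongr
      _ = _ := by
          push_cast
          simp only [pow_mul, sq_abs]
          ring
  have hGi : ∀ i, Integrable (fun ω => G i ω ^ (2 * r)) P := fun i =>
    integrable_pow_of_hasSubgaussianMGF (hd i) r
  have hXi : ∀ k, Integrable (fun ω => X k ω ^ (2 * r)) P := fun k =>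
    integrable_pow_of_hasSubgaussianMGF (hc k) r
  have hRi1 : Integrable (fun ω => ∑ i ∈ Finset.range (8 ^ m + 1), G i ω ^ (2 * r)) P :=
    integrable_finsetSum _ fun i _ => hGi i
  have hRi2 : Integrable (fun ω => ∑ k ∈ s, X k ω ^ (2 * r)) P :=
    integrable_finsetSum _ fun i _ => hXi i
  have hRi3 : Integrable (fun ω => (10 / 4 ^ m : ℝ) ^ (2 * r) *
      ((2 ^ m) ^ (2 * r - 1) * ∑ k ∈ s, X k ω ^ (2 * r))) P := (hRi2.const_mul _).const_mul _
  have hRi : Integrable R P := (hRi1.add hRi3).const_mul _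
  have hmeas : AEStronglyMeasurable (fun ω => ‖∑ k ∈ s, X k ω • eigC k‖ ^ (2 * r)) P := by
    refine AEStronglyMeasurable.pow (AEStronglyMeasurable.norm ?_) _
    exact Finset.aestronglyMeasurable_fun_sum _ fun k _ =>
      (hc k).aestronglyMeasurable.smul_const _
  have hint : Integrable (fun ω => ‖∑ k ∈ s, X k ω • eigC k‖ ^ (2 * r)) P :=
    hRi.mono' hmeas (Filter.Eventually.of_forall fun ω => by
      rw [Real.norm_of_nonneg (by positivity)]; exact hle ω)
  refine ⟨hint, (integral_mono hint hRi hle).trans ?_⟩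
  have hI1 : ∫ ω, ∑ i ∈ Finset.range (8 ^ m + 1), G i ω ^ (2 * r) ∂P ≤
      2 * momentConst r * (2 * K) ^ r * (1 / 2) ^ m := by
    rw [integral_finsetSum _ fun i _ => hGi i]
    calc _ ≤ ∑ i ∈ Finset.range (8 ^ m + 1), momentConst r * ((2 * K) ^ r * (1 / 16) ^ m) := by
          refine Finset.sum_le_sum fun i _ => ?_
          refine (integral_pow_le_of_hasSubgaussianMGF (hd i) hv0 (hdv i) r).trans ?_
          gcongr
          exact momentConst_nonneg r
      _ = (8 ^ m + 1) * (1 / 16) ^ m * (momentConst r * (2 * K) ^ r) := by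
          rw [Finset.sum_const, Finset.card_range, nsmul_eq_mul]; push_cast; ring
      _ ≤ (2 * 8 ^ m) * (1 / 16) ^ m * (momentConst r * (2 * K) ^ r) := by
          have := momentConst_nonneg r
          have : (1 : ℝ) ≤ 8 ^ m := one_le_pow₀ (by norm_num)
          gcongr
          linarith
      _ = _ := by
          have : (1 / 2 : ℝ) ^ m = 8 ^ m * (1 / 16) ^ m := by rw [← mul_pow]; norm_num
          rw [this]; ring
  have hI2 : ∫ ω, ∑ k ∈ s, X k ω ^ (2 * r) ∂P ≤ 2 ^ m * (momentConst r * K ^ r) := by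
    rw [integral_finsetSum _ fun i _ => hXi i]
    calc _ ≤ ∑ k ∈ s, momentConst r * K ^ r := Finset.sum_le_sum fun k _ =>
          integral_pow_le_of_hasSubgaussianMGF (hc k) hK (hcK' k) r
      _ = _ := by rw [Finset.sum_const, card_dyadicBlock, nsmul_eq_mul]; push_cast; ring
  have hI3 : ∫ ω, (10 / 4 ^ m : ℝ) ^ (2 * r) *
      ((2 ^ m) ^ (2 * r - 1) * ∑ k ∈ s, X k ω ^ (2 * r)) ∂P ≤
      10 ^ (2 * r) * momentConst r * K ^ r * (1 / 2) ^ m := by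
    rw [integral_const_mul, integral_const_mul]
    have hm0 := momentConst_nonneg r
    calc _ ≤ (10 / 4 ^ m : ℝ) ^ (2 * r) *
          ((2 ^ m) ^ (2 * r - 1) * (2 ^ m * (momentConst r * K ^ r))) := by gcongr
      _ = 10 ^ (2 * r) * momentConst r * K ^ r * (((1 / 4) ^ m) ^ (2 * r) * (2 ^ m) ^ (2 * r)) := by
          have : ((2 : ℝ) ^ m) ^ (2 * r) = (2 ^ m) ^ (2 * r - 1) * 2 ^ m := by
            rw [← pow_succ, Nat.sub_add_cancel (by omega)]
          rw [this, div_pow]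
          simp only [one_div, inv_pow]
          field_simp
      _ = 10 ^ (2 * r) * momentConst r * K ^ r * ((1 / 2) ^ m) ^ (2 * r) := by
          rw [← mul_pow, ← mul_pow]; norm_num
      _ ≤ 10 ^ (2 * r) * momentConst r * K ^ r * (1 / 2) ^ m := by
          gcongr
          exact pow_le_of_le_one (by positivity) (pow_le_one₀ (by norm_num) (by norm_num))
            (by omega)
  rw [hR, integral_const_mul, integral_add hRi1 hRi3, blockConst]
  calc _ ≤ 2 ^ (2 * r) * (2 * momentConst r * (2 * K) ^ r * (1 / 2) ^ m +
      10 ^ (2 * r) * momentConst r * K ^ r * (1 / 2) ^ m) := by gcongr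
    _ = _ := by ring

end Blocks

/-! ### Moments of random sine series. -/

section SineSeriesMoments

variable {Ω : Type*} [MeasurableSpace Ω] {P : Measure Ω}

lemma sum_range_dyadicBlock {M : Type*} [AddCommMonoid M] (f : ℕ → M) (N : ℕ) :
    ∑ m ∈ Finset.range N, ∑ k ∈ dyadicBlock m, f k = ∑ k ∈ Finset.range (2 ^ N - 1), f k := by
  induction N with
  | zero => simp
  | succ N ih =>
    rw [Finset.sum_range_succ, ih, dyadicBlock, Finset.range_eq_Ico, Finset.range_eq_Ico,
      Finset.sum_Ico_consecutive _ (Nat.zero_le _)]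
    exact Nat.sub_le_sub_right (Nat.pow_le_pow_right (by norm_num) (Nat.le_succ N)) 1

lemma summable_smul_eigC {x : ℕ → ℝ} (hx : Summable fun k => |x k|) :
    Summable fun k => x k • eigC k := by
  refine Summable.of_norm_bounded (hx.mul_right (Real.sqrt 2)) fun k => ?_
  rw [norm_smul, Real.norm_eq_abs]
  gcongr
  exact norm_eigC_le k

lemma aestronglyMeasurable_sum_eigC {X : ℕ → Ω → ℝ} (hX : ∀ k, AEStronglyMeasurable (X k) P)
    (s : Finset ℕ) : AEStronglyMeasurable (fun ω => ∑ k ∈ s, X k ω • eigC k) P :=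
  Finset.aestronglyMeasurable_fun_sum _ fun k _ => (hX k).smul_const _

lemma aestronglyMeasurable_tsum_eigC {X : ℕ → Ω → ℝ} (hX : ∀ k, AEStronglyMeasurable (X k) P)
    (hs : ∀ᵐ ω ∂P, Summable fun k => |X k ω|) :
    AEStronglyMeasurable (fun ω => ∑' k, X k ω • eigC k) P := by
  refine aestronglyMeasurable_of_tendsto_ae Filter.atTop
    (fun N => aestronglyMeasurable_sum_eigC hX (Finset.range N)) ?_
  filter_upwards [hs] with ω hω
  exact (summable_smul_eigC hω).hasSum.tendsto_sum_nat

/-- A bound for the moment of order `2 r` of the maximum of a random sine series. -/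
noncomputable def seriesConst (K : ℝ) (r : ℕ) : ℝ :=
  ∑' m : ℕ, (blockConst K r * (1 / 2) ^ m) ^ ((2 * r : ℕ) : ℝ)⁻¹

lemma blockConst_nonneg {K : ℝ} (hK : 0 < K) (r : ℕ) : 0 ≤ blockConst K r := by
  have := momentConst_nonneg r
  unfold blockConst
  positivity

lemma summable_seriesConst {K : ℝ} (hK : 0 < K) {r : ℕ} (hr : 1 ≤ r) :
    Summable fun m : ℕ => (blockConst K r * (1 / 2) ^ m) ^ ((2 * r : ℕ) : ℝ)⁻¹ := by
  have hr' : (0 : ℝ) < ((2 * r : ℕ) : ℝ)⁻¹ := by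
    have : (0 : ℝ) < ((2 * r : ℕ) : ℝ) := by exact_mod_cast (by omega : 0 < 2 * r)
    positivity
  have h : ∀ m : ℕ, (blockConst K r * (1 / 2) ^ m) ^ ((2 * r : ℕ) : ℝ)⁻¹ =
      blockConst K r ^ ((2 * r : ℕ) : ℝ)⁻¹ * ((1 / 2 : ℝ) ^ ((2 * r : ℕ) : ℝ)⁻¹) ^ m := by
    intro m
    rw [Real.mul_rpow (blockConst_nonneg hK r) (by positivity), ← Real.rpow_natCast,
      ← Real.rpow_natCast, ← Real.rpow_mul (by norm_num), ← Real.rpow_mul (by norm_num),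
      mul_comm (m : ℝ)]
  simp_rw [h]
  exact (summable_geometric_of_lt_one (by positivity)
    (Real.rpow_lt_one (by norm_num) (by norm_num) hr')).mul_left _

/-- Minkowski over the blocks bounds the partial sums, and Fatou passes to the limit. The
summability `hs` only identifies that limit and does not enter the bound. -/
lemma eLpNorm_tsum_eigC_le {K α : ℝ} (hK : 0 < K) {r : ℕ} (hr : 1 ≤ r)
    (hα : 4 ≤ (α - 1) * r) {X : ℕ → Ω → ℝ} (hX : iIndepFun X P) {c : ℕ → ℝ≥0}
    (hc : ∀ k, HasSubgaussianMGF (X k) (c k) P)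
    (hcK : ∀ k, (c k : ℝ) ≤ K * ((k : ℝ) + 1) ^ (-α))
    (hs : ∀ᵐ ω ∂P, Summable fun k => |X k ω|) :
    eLpNorm (fun ω => ∑' k, X k ω • eigC k) (2 * r : ℕ) P ≤ ENNReal.ofReal (seriesConst K r) := by
  have hmeas := fun s => aestronglyMeasurable_sum_eigC (P := P)
    (fun k => (hc k).aestronglyMeasurable) s
  have hblock : ∀ m, eLpNorm (fun ω => ∑ k ∈ dyadicBlock m, X k ω • eigC k) (2 * r : ℕ) P ≤
      ENNReal.ofReal ((blockConst K r * (1 / 2) ^ m) ^ ((2 * r : ℕ) : ℝ)⁻¹) := by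
    intro m
    obtain ⟨h1, h2⟩ := integral_norm_block_pow_le hK hr hα hX hc hcK m
    have h0 : ((2 * r : ℕ) : ℝ≥0∞) ≠ 0 := by exact_mod_cast (by omega : 2 * r ≠ 0)
    have hL : MemLp (fun ω => ∑ k ∈ dyadicBlock m, X k ω • eigC k) (2 * r : ℕ) P := by
      rw [← integrable_norm_rpow_iff (hmeas _) h0 (ENNReal.natCast_ne_top _)]
      simpa only [ENNReal.toReal_natCast, Real.rpow_natCast] using h1
    rw [hL.eLpNorm_eq_integral_rpow_norm h0 (ENNReal.natCast_ne_top _)]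
    simp only [ENNReal.toReal_natCast, Real.rpow_natCast]
    gcongr
  refine Lp.eLpNorm_le_of_ae_tendsto (u := Filter.atTop)
    (f := fun N ω => ∑ k ∈ Finset.range (2 ^ N - 1), X k ω • eigC k)
    (Filter.Eventually.of_forall fun N => ?_) (fun N => hmeas _) ?_
  · have h1 : (fun ω => ∑ k ∈ Finset.range (2 ^ N - 1), X k ω • eigC k) =
        ∑ m ∈ Finset.range N, fun ω => ∑ k ∈ dyadicBlock m, X k ω • eigC k := by
      ext1 ω
      rw [Finset.sum_apply, sum_range_dyadicBlock]
    rw [h1]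
    have h2r : (1 : ℝ≥0∞) ≤ (2 * r : ℕ) := by exact_mod_cast (by omega : 1 ≤ 2 * r)
    refine (eLpNorm_sum_le (fun m _ => hmeas _) h2r).trans ?_
    refine (Finset.sum_le_sum fun m _ => hblock m).trans ?_
    have hb := blockConst_nonneg hK r
    rw [← ENNReal.ofReal_sum_of_nonneg fun m _ => by positivity]
    exact ENNReal.ofReal_le_ofReal ((summable_seriesConst hK hr).sum_le_tsum _
      fun m _ => by positivity)
  · filter_upwards [hs] with ω hω
    refine (summable_smul_eigC hω).hasSum.tendsto_sum_nat.comp ?_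
    refine Filter.tendsto_atTop_mono (fun N => ?_) Filter.tendsto_id
    have := Nat.lt_two_pow_self (n := N)
    simp only [id]
    omega

end SineSeriesMoments

/-! ### Coefficients of the discrete process. -/

section FractionalBrownianMotion

variable {Ω : Type*} [MeasurableSpace Ω] {P : Measure Ω} [IsProbabilityMeasure P]

/-- The covariance gives variance `|s - t|^(2H)`, written as a square to fit
`hasSubgaussianMGF_sum_mul`. -/
lemma hasSubgaussianMGF_fbm_sub {H : ℝ} (hH : 0 < H) {X : ℝ≥0 → Ω → ℝ}
    (hX : IsFractionalBrownianMotion H X P) (s t : ℝ≥0) :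
    HasSubgaussianMGF (fun ω => X s ω - X t ω) ((nndist s t ^ H) ^ 2) P := by
  have hL : ∀ u, MemLp (X u) 2 P := fun u => (hX.gaussian.hasGaussianLaw_eval u).memLp_two
  have hI : ∀ u v, Integrable (fun ω => X u ω * X v ω) P := fun u v =>
    (hL u).integrable_mul (hL v)
  refine hasSubgaussianMGF_of_hasGaussianLaw hX.gaussian.hasGaussianLaw_fun_sub ?_ ?_
  · rw [integral_sub ((hL s).integrable (by norm_num)) ((hL t).integrable (by norm_num)),
      hX.mean, hX.mean, sub_zero]
  · have h1 : ∀ ω, (X s ω - X t ω) ^ 2 =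
        X s ω * X s ω - 2 * (X s ω * X t ω) + X t ω * X t ω := fun ω => by ring
    simp_rw [h1]
    have h3 : Integrable (fun ω => X s ω * X s ω - 2 * (X s ω * X t ω)) P :=
      (hI s s).sub ((hI s t).const_mul 2)
    rw [integral_add h3 (hI t t),
      integral_sub (hI s s) ((hI s t).const_mul 2), integral_const_mul, hX.cov, hX.cov, hX.cov]
    have h0 : (0 : ℝ) ^ (2 * H) = 0 := Real.zero_rpow (by positivity)
    have h2 : |(s : ℝ) - t| ^ (2 * H) = (|(s : ℝ) - t| ^ H) ^ 2 := by
      rw [mul_comm, Real.rpow_mul (abs_nonneg _), Real.rpow_two]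
    simp only [sub_self, abs_zero, h0, NNReal.coe_pow, NNReal.coe_rpow, coe_nndist,
      NNReal.dist_eq]
    rw [← h2]
    ring

/-- Summation by parts for a geometric weight. -/
lemma sum_geom_mul_sub (a : ℝ) (d : ℕ → ℝ) (n : ℕ) :
    ∑ m ∈ Finset.range n, a ^ (m + 1) * (d m - d (m + 1)) =
      d 0 - a ^ n * d n - (1 - a) * ∑ m ∈ Finset.range n, a ^ m * d m := by
  induction n with
  | zero => simp
  | succ n ih => rw [Finset.sum_range_succ, ih, Finset.sum_range_succ]; ring

/-- A discrete form of `∫ e^(-s) s^H ds < ∞`, uniform in the mesh `x`. Half of the exponential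
absorbs the power, leaving a geometric series in `y = e^(-x/2)`, and `1 - e^(-x) = (1 - y)(1 + y)`
cancels its sum. The boundary term costs `1`, the sum `4`. -/
lemma sum_exp_mul_rpow_le {H : ℝ} (hH : 0 < H) (hH1 : H ≤ 1) {x : ℝ} (hx : 0 < x) (n : ℕ) :
    Real.exp (-x) ^ n * (n * x) ^ H +
      (1 - Real.exp (-x)) * ∑ m ∈ Finset.range n, Real.exp (-x) ^ m * (m * x) ^ H ≤ 5 := by
  have hpow : ∀ y : ℝ, 0 ≤ y → y ^ H ≤ 1 + y := by
    intro y hy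
    rcases le_total y 1 with h | h
    · linarith [Real.rpow_le_one hy h hH.le]
    · linarith [(Real.rpow_le_rpow_of_exponent_le h hH1).trans_eq (Real.rpow_one y)]
  have hexp : ∀ m : ℕ, Real.exp (-x) ^ m = Real.exp (-(m * x)) := fun m => by
    rw [← Real.exp_nat_mul]; congr 1; ring
  have h1 : Real.exp (-x) ^ n * (n * x) ^ H ≤ 1 := by
    rw [hexp]
    calc _ ≤ Real.exp (-(n * x)) * Real.exp (n * x) := by
          gcongr
          exact (hpow _ (by positivity)).trans (by linarith [Real.add_one_le_exp ((n : ℝ) * x)])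
      _ = 1 := by rw [← Real.exp_add]; simp
  set y := Real.exp (-(x / 2)) with hy
  have hy0 : 0 < y := Real.exp_pos _
  have hy1 : y < 1 := by rw [hy, Real.exp_lt_one_iff]; linarith
  have hyx : Real.exp (-x) = y ^ 2 := by rw [hy, ← Real.exp_nat_mul]; congr 1; push_cast; ring
  have h2 : ∀ m : ℕ, Real.exp (-x) ^ m * (m * x) ^ H ≤ 2 * y ^ m := by
    intro m
    have e1 : y ^ m = Real.exp (-(m * x)) * Real.exp (m * x / 2) := by
      rw [hy, ← Real.exp_nat_mul, ← Real.exp_add]; congr 1; ring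
    rw [hexp, e1]
    calc _ ≤ Real.exp (-(m * x)) * (2 * Real.exp (m * x / 2)) := by
          gcongr
          exact (hpow _ (by positivity)).trans
            (by linarith [Real.add_one_le_exp ((m : ℝ) * x / 2)])
      _ = _ := by ring
  have h3 : ∑ m ∈ Finset.range n, y ^ m ≤ (1 - y)⁻¹ := by
    rw [← tsum_geometric_of_lt_one hy0.le hy1]
    exact (summable_geometric_of_lt_one hy0.le hy1).sum_le_tsum _ fun m _ => by positivity
  have h4 : (1 - Real.exp (-x)) * ∑ m ∈ Finset.range n, Real.exp (-x) ^ m * (m * x) ^ H ≤ 4 := by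
    have h5 : 0 ≤ 1 - Real.exp (-x) := by
      rw [hyx]; nlinarith
    calc _ ≤ (1 - Real.exp (-x)) * ∑ m ∈ Finset.range n, 2 * y ^ m := by
          gcongr _ * ?_; exact Finset.sum_le_sum fun m _ => h2 m
      _ ≤ (1 - Real.exp (-x)) * (2 * (1 - y)⁻¹) := by
          rw [← Finset.mul_sum]; gcongr
      _ = 2 * (1 + y) := by
          rw [hyx]
          have : 1 - y ≠ 0 := by linarith
          field_simp
          ring
      _ ≤ 4 := by linarith
  linarith

lemma eigval_pos (k : ℕ) : 0 < eigval k := by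
  unfold eigval; positivity

lemma sq_le_eigval (k : ℕ) : ((k : ℝ) + 1) ^ 2 ≤ eigval k := by
  have : (1 : ℝ) ≤ Real.pi ^ 2 := one_le_pow₀ (by linarith [Real.pi_gt_three])
  exact le_mul_of_one_le_right (by positivity) this

/-- The coefficient of `Z_n` with respect to the `k`-th eigenfunction. -/
noncomputable def coefZ (β : ℕ → ℝ≥0 → Ω → ℝ) (Δt : ℝ≥0) (n k : ℕ) (ω : Ω) : ℝ :=
  ∑ j ∈ Finset.range n,
    increment β Δt k j ω * Real.exp (-eigval k * ((n : ℝ) * (Δt : ℝ) - (j : ℝ) * (Δt : ℝ)))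

-- Minkowski on the increments themselves would give about `Δt^H / (1 - e^(-λ_k Δt))`, which blows
-- up as `Δt → 0` for `H < 1`. Measuring displacements from the final time makes the term at lag `0`
-- vanish and supplies the factor `1 - e^(-λ_k Δt)` at the others, apart from the boundary term `m =
-- n`.
omit [MeasurableSpace Ω] in
lemma coefZ_eq (β : ℕ → ℝ≥0 → Ω → ℝ) (Δt : ℝ≥0) (n k : ℕ) (ω : Ω) :
    coefZ β Δt n k ω = ∑ m ∈ Finset.range (n + 1),
      (if m = n then -Real.exp (-(eigval k * Δt)) ^ n
        else -((1 - Real.exp (-(eigval k * Δt))) * Real.exp (-(eigval k * Δt)) ^ m)) *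
        (β k (((n - m : ℕ) : ℝ≥0) * Δt) ω - β k ((n : ℝ≥0) * Δt) ω) := by
  set a := Real.exp (-(eigval k * Δt)) with ha
  set d : ℕ → ℝ := fun m => β k (((n - m : ℕ) : ℝ≥0) * Δt) ω - β k ((n : ℝ≥0) * Δt) ω with hd
  have h1 : coefZ β Δt n k ω = ∑ m ∈ Finset.range n, a ^ (m + 1) * (d m - d (m + 1)) := by
    rw [coefZ, ← Finset.sum_range_reflect]
    refine Finset.sum_congr rfl fun m hm => ?_
    have hm' := Finset.mem_range.1 hm
    have e1 : n - 1 - m + 1 = n - m := by omega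
    have e2 : n - 1 - m = n - (m + 1) := by omega
    rw [increment, e1, e2, mul_comm, hd]
    dsimp only
    congr 1
    · rw [ha, ← Real.exp_nat_mul, Nat.cast_sub (by omega)]
      congr 1
      push_cast
      ring
    · ring
  have h0 : d 0 = 0 := by simp [hd]
  rw [h1, sum_geom_mul_sub, h0, Finset.sum_range_succ, if_pos rfl, Finset.mul_sum,
    zero_sub, sub_eq_add_neg, add_comm, ← Finset.sum_neg_distrib]
  congr 1
  · refine Finset.sum_congr rfl fun m hm => ?_
    rw [if_neg (Finset.mem_range.1 hm).ne]
    ring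
  · ring

/-- With `x = λ_k Δt`, scaling gives `(m Δt)^H = (m x)^H λ_k^(-H)`, so `Δt` and `n` survive only in
the sum bounded by `5`. -/
lemma hasSubgaussianMGF_coefZ {H : ℝ} (hH : 0 < H) (hH1 : H ≤ 1) {β : ℕ → ℝ≥0 → Ω → ℝ} {k : ℕ}
    (hβ : IsFractionalBrownianMotion H (β k) P) {Δt : ℝ≥0} (hΔ : 0 < Δt) (n : ℕ) :
    ∃ c : ℝ≥0, HasSubgaussianMGF (coefZ β Δt n k) c P ∧
      (c : ℝ) ≤ 25 * ((k : ℝ) + 1) ^ (-(4 * H)) := by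
  have hΔ' : (0 : ℝ) < Δt := hΔ
  have hlam := eigval_pos k
  set x := eigval k * Δt with hx
  have hx0 : 0 < x := by positivity
  have h := hasSubgaussianMGF_sum_mul (P := P) (Finset.range (n + 1))
    (fun m => if m = n then -Real.exp (-x) ^ n
        else -((1 - Real.exp (-x)) * Real.exp (-x) ^ m))
    (fun m => nndist (((n - m : ℕ) : ℝ≥0) * Δt) ((n : ℝ≥0) * Δt) ^ H)
    (fun m ω => β k (((n - m : ℕ) : ℝ≥0) * Δt) ω - β k ((n : ℝ≥0) * Δt) ω)
    (fun m _ => hasSubgaussianMGF_fbm_sub hH hβ _ _)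
  have hfun : coefZ β Δt n k = fun ω => _ := funext fun ω => coefZ_eq β Δt n k ω
  rw [← hx] at hfun
  rw [← hfun] at h
  refine ⟨_, h, ?_⟩
  have hdist : ∀ m ≤ n, ((nndist (((n - m : ℕ) : ℝ≥0) * Δt) ((n : ℝ≥0) * Δt) ^ H : ℝ≥0) : ℝ) =
      (m * x) ^ H * eigval k ^ (-H) := by
    intro m hm
    rw [NNReal.coe_rpow, coe_nndist, NNReal.dist_eq]
    rw [NNReal.coe_mul, NNReal.coe_mul, NNReal.coe_natCast, NNReal.coe_natCast, Nat.cast_sub hm]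
    have e1 : |((n : ℝ) - m) * Δt - n * Δt| = (m * x) * (eigval k)⁻¹ := by
      rw [← sub_mul, abs_mul, abs_of_pos hΔ', sub_sub_cancel_left, abs_neg, Nat.abs_cast, hx]
      field_simp
    rw [e1, Real.mul_rpow (by positivity) (by positivity), Real.inv_rpow hlam.le,
      Real.rpow_neg hlam.le]
  have hexp1 : 0 ≤ 1 - Real.exp (-x) := by
    have : Real.exp (-x) ≤ 1 := Real.exp_le_one_iff.2 (by linarith)
    linarith
  have hsum : ((∑ m ∈ Finset.range (n + 1), ‖if m = n then -Real.exp (-x) ^ n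
        else -((1 - Real.exp (-x)) * Real.exp (-x) ^ m)‖₊ *
      nndist (((n - m : ℕ) : ℝ≥0) * Δt) ((n : ℝ≥0) * Δt) ^ H : ℝ≥0) : ℝ) ≤
      5 * eigval k ^ (-H) := by
    rw [NNReal.coe_sum, Finset.sum_range_succ, if_pos rfl, NNReal.coe_mul, hdist n le_rfl]
    have e2 : ∀ m ∈ Finset.range n, ((‖if m = n then -Real.exp (-x) ^ n
        else -((1 - Real.exp (-x)) * Real.exp (-x) ^ m)‖₊ *
      nndist (((n - m : ℕ) : ℝ≥0) * Δt) ((n : ℝ≥0) * Δt) ^ H : ℝ≥0) : ℝ) =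
      (1 - Real.exp (-x)) * (Real.exp (-x) ^ m * (m * x) ^ H) * eigval k ^ (-H) := by
      intro m hm
      have hm' := Finset.mem_range.1 hm
      rw [if_neg hm'.ne, NNReal.coe_mul, hdist m hm'.le, coe_nnnorm, norm_neg,
        Real.norm_of_nonneg (by positivity)]
      ring
    rw [Finset.sum_congr rfl e2, ← Finset.sum_mul, ← Finset.mul_sum, coe_nnnorm, norm_neg,
      Real.norm_of_nonneg (by positivity), ← mul_assoc, ← add_mul, add_comm]
    gcongr
    exact sum_exp_mul_rpow_le hH hH1 hx0 n
  rw [NNReal.coe_pow]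
  calc _ ≤ (5 * eigval k ^ (-H)) ^ 2 := by gcongr
    _ = 25 * eigval k ^ (-(2 * H)) := by
        rw [mul_pow, ← Real.rpow_natCast (eigval k ^ (-H)), ← Real.rpow_mul hlam.le]
        norm_num
        ring_nf
    _ ≤ 25 * (((k : ℝ) + 1) ^ 2) ^ (-(2 * H)) := by
        gcongr 25 * ?_
        exact Real.rpow_le_rpow_of_nonpos (by positivity) (sq_le_eigval k) (by linarith)
    _ = 25 * ((k : ℝ) + 1) ^ (-(4 * H)) := by
        rw [← Real.rpow_natCast, ← Real.rpow_mul (by positivity)]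
        congr 2; push_cast; ring

omit [IsProbabilityMeasure P] in
lemma iIndepFun_coefZ {β : ℕ → ℝ≥0 → Ω → ℝ}
    (hindep : iIndepFun (fun (k : ℕ) (ω : Ω) (t : ℝ≥0) => β k t ω) P) (Δt : ℝ≥0) (n : ℕ) :
    iIndepFun (coefZ β Δt n) P :=
  hindep.comp (fun k f => ∑ j ∈ Finset.range n,
    (f (((j + 1 : ℕ) : ℝ≥0) * Δt) - f ((j : ℝ≥0) * Δt)) *
      Real.exp (-eigval k * ((n : ℝ) * (Δt : ℝ) - (j : ℝ) * (Δt : ℝ)))) fun k => by fun_prop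

omit [IsProbabilityMeasure P] in
lemma ae_summable_of_summable_integral {f : ℕ → Ω → ℝ} (hf : ∀ k, Integrable (f k) P)
    (hs : Summable fun k => ∫ ω, |f k ω| ∂P) : ∀ᵐ ω ∂P, Summable fun k => |f k ω| := by
  have h1 : ∫⁻ ω, ∑' k, ‖f k ω‖ₑ ∂P ≠ ⊤ := by
    rw [lintegral_tsum fun k => (hf k).1.enorm]
    have : ∀ k, ∫⁻ ω, ‖f k ω‖ₑ ∂P = ENNReal.ofReal (∫ ω, |f k ω| ∂P) := fun k =>
      (ofReal_integral_norm_eq_lintegral_enorm (hf k)).symm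
    simp_rw [this]
    exact hs.tsum_ofReal_ne_top
  filter_upwards [ae_lt_top' (AEMeasurable.tsum fun k => (hf k).1.enorm) h1] with ω hω
  have := ENNReal.summable_toReal hω.ne
  simpa using this

lemma ae_summable_increment {H : ℝ} (hH : 0 < H) {β : ℕ → ℝ≥0 → Ω → ℝ}
    (hβ : ∀ k, IsFractionalBrownianMotion H (β k) P) (Δt : ℝ≥0) (j : ℕ) {t : ℝ} (ht : 0 < t) :
    ∀ᵐ ω ∂P, Summable fun k => |increment β Δt k j ω * Real.exp (-eigval k * t)| := by
  have hsub : ∀ k, HasSubgaussianMGF (increment β Δt k j) _ P := fun k =>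
    hasSubgaussianMGF_fbm_sub hH (hβ k) _ _
  refine ae_summable_of_summable_integral
    (fun k => (hsub k).integrable.mul_const _) ?_
  -- The added `1` keeps `v` positive even for `Δt = 0`; the bound may depend on `Δt` and `t`, as
  -- only convergence is at stake.
  set v : ℝ := (((nndist (((j + 1 : ℕ) : ℝ≥0) * Δt) ((j : ℝ≥0) * Δt) ^ H) ^ 2 : ℝ≥0) : ℝ) + 1
  have hbound : ∀ k, ∫ ω, |increment β Δt k j ω * Real.exp (-eigval k * t)| ∂P ≤
      (1 + momentConst 1 * v ^ 1) * Real.exp (-t) ^ k := by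
    intro k
    have h1 := integral_pow_le_of_hasSubgaussianMGF (hsub k) (v := v) (by positivity)
      (by simp only [v]; linarith) 1
    have hi := integrable_pow_of_hasSubgaussianMGF (hsub k) 1
    simp_rw [abs_mul]
    rw [integral_mul_const, abs_of_pos (Real.exp_pos _)]
    have h2 : ∫ ω, |increment β Δt k j ω| ∂P ≤ 1 + momentConst 1 * v ^ 1 := by
      calc _ ≤ ∫ ω, (1 + increment β Δt k j ω ^ (2 * 1)) ∂P := by
            refine integral_mono (hsub k).integrable.abs ((integrable_const _).add hi) fun ω => ?_
            dsimp only
            rw [mul_one, ← sq_abs]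
            nlinarith [sq_nonneg (|increment β Δt k j ω| - 1), abs_nonneg (increment β Δt k j ω)]
        _ = 1 + ∫ ω, increment β Δt k j ω ^ (2 * 1) ∂P := by
            rw [integral_add (integrable_const _) hi]; simp
        _ ≤ _ := by gcongr
    have h3 : Real.exp (-eigval k * t) ≤ Real.exp (-t) ^ k := by
      rw [← Real.exp_nat_mul, Real.exp_le_exp]
      have := sq_le_eigval k
      have hk : (0 : ℝ) ≤ k := by positivity
      nlinarith [mul_nonneg hk hk, mul_nonneg ht.le (by nlinarith : 0 ≤ eigval k - k)]
    have := momentConst_nonneg 1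
    gcongr
  refine Summable.of_nonneg_of_le (fun k => integral_nonneg fun ω => abs_nonneg _) hbound ?_
  exact (summable_geometric_of_lt_one (Real.exp_nonneg _)
    (Real.exp_lt_one_iff.2 (by linarith))).mul_left _

end FractionalBrownianMotion

/-! ### The sine basis in `L²(0,1)` and the embedding of `C([0,1])`. -/

section Embedding

lemma integral_eigfun_mul_eigfun (k l : ℕ) :
    ∫ ξ in (0 : ℝ)..1, eigfun k ξ * eigfun l ξ = if k = l then 1 else 0 := by
  have hcos : ∀ c : ℤ, ∫ ξ in (0 : ℝ)..1, Real.cos (c * Real.pi * ξ) = if c = 0 then 1 else 0 := by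
    intro c
    split_ifs with h
    · simp [h]
    · have hc : (c : ℝ) * Real.pi ≠ 0 := mul_ne_zero (by exact_mod_cast h) Real.pi_ne_zero
      rw [intervalIntegral.integral_comp_mul_left (fun x => Real.cos x) hc, integral_cos]
      simp [Real.sin_int_mul_pi]
  have h1 : ∀ ξ : ℝ, eigfun k ξ * eigfun l ξ =
      Real.cos (((k - l : ℤ) : ℝ) * Real.pi * ξ) -
        Real.cos (((k + l + 2 : ℤ) : ℝ) * Real.pi * ξ) := by
    intro ξ
    have e1 : ((k - l : ℤ) : ℝ) * Real.pi * ξ =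
        ((k : ℝ) + 1) * Real.pi * ξ - ((l : ℝ) + 1) * Real.pi * ξ := by push_cast; ring
    have e2 : ((k + l + 2 : ℤ) : ℝ) * Real.pi * ξ =
        ((k : ℝ) + 1) * Real.pi * ξ + ((l : ℝ) + 1) * Real.pi * ξ := by push_cast; ring
    rw [e1, e2, Real.cos_sub, Real.cos_add, eigfun, eigfun]
    have h2 : Real.sqrt 2 * Real.sqrt 2 = 2 := Real.mul_self_sqrt (by norm_num)
    linear_combination (Real.sin (((k : ℝ) + 1) * Real.pi * ξ) *
      Real.sin (((l : ℝ) + 1) * Real.pi * ξ)) * h2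
  simp_rw [h1]
  rw [intervalIntegral.integral_sub (Continuous.intervalIntegrable (by fun_prop) _ _)
    (Continuous.intervalIntegrable (by fun_prop) _ _), hcos, hcos,
    if_neg (by omega : ¬((k : ℤ) + l + 2 = 0)), sub_zero]
  simp only [sub_eq_zero, Nat.cast_inj]

lemma inner_eigvec (k l : ℕ) : inner ℝ (eigvec k) (eigvec l) = if k = l then (1 : ℝ) else 0 := by
  rw [L2.inner_def, ← integral_eigfun_mul_eigfun k l, intervalIntegral.integral_of_le zero_le_one,
    ← integral_Ioc_eq_integral_Ioo.symm]
  refine integral_congr_ae ?_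
  filter_upwards [(memLp_eigfun k).coeFn_toLp, (memLp_eigfun l).coeFn_toLp] with ξ h1 h2
  rw [eigvec, eigvec, h1, h2]
  simp [mul_comm]

lemma semigroup_eigvec (t : ℝ) (k : ℕ) :
    semigroup t (eigvec k) = Real.exp (-eigval k * t) • eigvec k := by
  rw [semigroup, tsum_eq_single k]
  · rw [inner_eigvec, if_pos rfl, mul_one]
  · intro l hl
    rw [inner_eigvec, if_neg hl.symm, mul_zero, zero_smul]

lemma memLp_IccExtend (f : E) :
    MemLp (IccExtend zero_le_one f) 2 (volume.restrict (Ioo (0 : ℝ) 1)) :=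
  MemLp.of_bound (f.continuous.Icc_extend').aestronglyMeasurable ‖f‖
    (Filter.Eventually.of_forall fun _ => f.norm_coe_le_norm _)

/-- The embedding of `C([0,1])` into `L²(0,1)`. -/
noncomputable def embed : E →L[ℝ] L2I :=
  LinearMap.mkContinuous
    { toFun := fun f => (memLp_IccExtend f).toLp _
      map_add' := fun f g => by
        rw [← MemLp.toLp_add]; rfl
      map_smul' := fun c f => by
        rw [RingHom.id_apply, ← MemLp.toLp_const_smul]; rfl } 1 fun f => by
    have h : ‖(memLp_IccExtend f).toLp _‖ ≤ _ := Lp.norm_le_of_ae_bound (C := ‖f‖) (norm_nonneg _) (by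
      filter_upwards [(memLp_IccExtend f).coeFn_toLp] with ξ hξ
      rw [hξ]
      exact f.norm_coe_le_norm _)
    simpa [measureUnivNNReal] using h

lemma norm_embed_le (f : E) : ‖embed f‖ ≤ ‖f‖ := by
  have := embed.le_of_opNorm_le (LinearMap.mkContinuous_norm_le _ zero_le_one _) f
  rwa [one_mul] at this

lemma represents_embed (f : E) : Represents f (embed f) :=
  (memLp_IccExtend f).coeFn_toLp

/-- Continuous functions that agree almost everywhere on an interval agree on it, so the choice made
in `toE` is harmless. -/
lemma represents_unique {f g : E} {x : L2I} (hf : Represents f x) (hg : Represents g x) :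
    f = g := by
  have h : IccExtend zero_le_one f =ᵐ[volume.restrict (Icc (0 : ℝ) 1)] IccExtend zero_le_one g := by
    rw [← Measure.restrict_congr_set Ioo_ae_eq_Icc]
    exact hf.symm.trans hg
  have h2 := Measure.eqOn_Icc_of_ae_eq volume zero_ne_one h
    f.continuous.Icc_extend'.continuousOn g.continuous.Icc_extend'.continuousOn
  ext ξ
  simpa [IccExtend_of_mem _ _ ξ.2] using h2 ξ.2

lemma inE_embed (f : E) : InE (embed f) := ⟨f, represents_embed f⟩

lemma toE_embed (f : E) : toE (embed f) = f := by
  rw [toE, dif_pos (inE_embed f)]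
  exact represents_unique (inE_embed f).choose_spec (represents_embed f)

lemma embed_eigC (k : ℕ) : embed (eigC k) = eigvec k := by
  refine Lp.ext ?_
  filter_upwards [represents_embed (eigC k), (memLp_eigfun k).coeFn_toLp,
    ae_restrict_mem measurableSet_Ioo] with ξ h1 h2 h3
  rw [h1, eigvec, h2, IccExtend_of_mem _ _ (Ioo_subset_Icc_self h3), eigC_apply]

end Embedding

/-! ### The process `Z_n` and its uniform moments. -/

section DiscreteOU

variable {Ω : Type*} [MeasurableSpace Ω] {P : Measure Ω} [IsProbabilityMeasure P]

/-- The continuous representative of `Z_n`. -/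
noncomputable def contZ (β : ℕ → ℝ≥0 → Ω → ℝ) (Δt : ℝ≥0) (n : ℕ) (ω : Ω) : E :=
  ∑' k, coefZ β Δt n k ω • eigC k

omit [MeasurableSpace Ω] in
lemma noiseTerm_eq (β : ℕ → ℝ≥0 → Ω → ℝ) (Δt : ℝ≥0) (t : ℝ) (j : ℕ) (ω : Ω) (k : ℕ) :
    noiseTerm β Δt t j ω k =
      embed ((increment β Δt k j ω * Real.exp (-eigval k * t)) • eigC k) := by
  rw [noiseTerm, semigroup_eigvec, map_smul, embed_eigC, smul_smul]

/-- Almost surely, all the series in the definition of `Z_n` converge absolutely in `C([0,1])`. -/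
lemma ae_summable_coefZ {H : ℝ} (hH : 0 < H) {β : ℕ → ℝ≥0 → Ω → ℝ}
    (hβ : ∀ k, IsFractionalBrownianMotion H (β k) P) {Δt : ℝ≥0} (hΔ : 0 < Δt) (n : ℕ) :
    ∀ᵐ ω ∂P, (Summable fun k => |coefZ β Δt n k ω|) ∧ DefinedInL2 β Δt n ω ∧
      Z β Δt n ω = embed (contZ β Δt n ω) := by
  have h : ∀ᵐ ω ∂P, ∀ j ∈ Finset.range n, Summable fun k => |increment β Δt k j ω *
      Real.exp (-eigval k * ((n : ℝ) * (Δt : ℝ) - (j : ℝ) * (Δt : ℝ)))| := by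
    refine (Finset.eventually_all _).2 fun j hj => ?_
    refine ae_summable_increment hH hβ Δt j ?_
    have h1 : (j : ℝ) < n := by exact_mod_cast Finset.mem_range.1 hj
    have h2 : (0 : ℝ) < Δt := hΔ
    nlinarith
  filter_upwards [h] with ω hω
  refine ⟨?_, fun j hj => ?_, ?_⟩
  · exact Summable.of_nonneg_of_le (fun k => abs_nonneg _)
      (fun k => Finset.abs_sum_le_sum_abs _ _) (summable_sum hω)
  · simp_rw [funext (noiseTerm_eq β Δt _ j ω)]
    exact embed.summable (summable_smul_eigC (hω j (Finset.mem_range.2 hj)))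
  · simp_rw [Z, contZ, coefZ, Finset.sum_smul]
    rw [Summable.tsum_finsetSum fun j hj => summable_smul_eigC (hω j hj), map_sum]
    refine Finset.sum_congr rfl fun j hj => ?_
    rw [embed.map_tsum (summable_smul_eigC (hω j hj))]
    exact tsum_congr fun k => noiseTerm_eq β Δt _ j ω k

lemma ae_toE_eq {H : ℝ} (hH : 0 < H) {β : ℕ → ℝ≥0 → Ω → ℝ}
    (hβ : ∀ k, IsFractionalBrownianMotion H (β k) P) {Δt : ℝ≥0} (hΔ : 0 < Δt) (n : ℕ) :
    (fun ω => toE (Z β Δt n ω)) =ᵐ[P] contZ β Δt n := by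
  filter_upwards [ae_summable_coefZ hH hβ hΔ n] with ω hω
  rw [hω.2.2, toE_embed]

lemma aestronglyMeasurable_contZ {H : ℝ} (hH : 0 < H) {β : ℕ → ℝ≥0 → Ω → ℝ}
    (hβ : ∀ k, IsFractionalBrownianMotion H (β k) P) {Δt : ℝ≥0} (hΔ : 0 < Δt) (n : ℕ) :
    AEStronglyMeasurable (contZ β Δt n) P := by
  refine aestronglyMeasurable_tsum_eigC (fun k => ?_)
    ((ae_summable_coefZ hH hβ hΔ n).mono fun ω hω => hω.1)
  have hm := fun k => (hβ k).measurable
  unfold coefZ increment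
  fun_prop

lemma exists_eLpNorm_contZ_le {H : ℝ} (hH : 1 / 4 < H) (hH1 : H ≤ 1) {β : ℕ → ℝ≥0 → Ω → ℝ}
    (hβ : ∀ k, IsFractionalBrownianMotion H (β k) P)
    (hindep : iIndepFun (fun (k : ℕ) (ω : Ω) (t : ℝ≥0) => β k t ω) P) (p : ℕ) :
    ∃ C : ℝ≥0∞, C < ⊤ ∧ ∀ Δt : ℝ≥0, 0 < Δt → ∀ n, eLpNorm (contZ β Δt n) p P ≤ C := by
  have hH0 : 0 < H := by linarith
  -- The condition `H > 1/4` makes such an exponent exist. Taking also `r ≥ p` lets the moment of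
  -- order `2r` control that of order `p`.
  obtain ⟨r₀, hr₀⟩ := exists_nat_ge (4 / (4 * H - 1))
  set r := max (max r₀ p) 1
  have hα : 4 ≤ (4 * H - 1) * r := by
    have h1 : (r₀ : ℝ) ≤ r := by
      exact_mod_cast (le_max_left r₀ p).trans (le_max_left _ _)
    rw [← div_le_iff₀' (by linarith)]
    exact hr₀.trans h1
  have hpr : (p : ℝ≥0∞) ≤ (2 * r : ℕ) := by
    have : p ≤ r := (le_max_right r₀ p).trans (le_max_left _ _)
    exact_mod_cast (by omega : p ≤ 2 * r)
  refine ⟨ENNReal.ofReal (seriesConst 25 r), ENNReal.ofReal_lt_top, fun Δt hΔ n => ?_⟩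
  choose c hc hcK using fun k => hasSubgaussianMGF_coefZ hH0 hH1 (hβ k) hΔ n
  exact (eLpNorm_le_eLpNorm_of_exponent_le hpr (aestronglyMeasurable_contZ hH0 hβ hΔ n)).trans
    (eLpNorm_tsum_eigC_le (by norm_num) (le_max_right _ _) hα (iIndepFun_coefZ hindep Δt n) hc hcK
      ((ae_summable_coefZ hH0 hβ hΔ n).mono fun ω hω => hω.1))

end DiscreteOU

end FracOU

open FracOU
theorem mainTheorem6 {Ω : Type*} [MeasurableSpace Ω] (P : Measure Ω) [IsProbabilityMeasure P]
    (H : ℝ) (hH : H ∈ Ioo (1 / 4 : ℝ) (1 / 2) ∪ Ioo (1 / 2 : ℝ) 1)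
    (β : ℕ → ℝ≥0 → Ω → ℝ)
    (hβ : ∀ k, IsFractionalBrownianMotion H (β k) P)
    (hindep : iIndepFun (fun (k : ℕ) (ω : Ω) (t : ℝ≥0) => β k t ω) P) :
    (∀ Δt ∈ Ioo (0 : ℝ≥0) 1, ∀ n : ℕ,
      (∀ᵐ ω ∂P, DefinedInL2 β Δt n ω ∧ InE (Z β Δt n ω)) ∧
      AEStronglyMeasurable (Z β Δt n) P ∧
      AEStronglyMeasurable (fun ω => toE (Z β Δt n ω)) P) ∧
    ∀ p : ℕ, 1 ≤ p →
      (⨆ Δt ∈ Ioo (0 : ℝ≥0) 1, ⨆ n : ℕ, eLpNorm (Z β Δt n) (p : ℝ≥0∞) P) +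
        (⨆ Δt ∈ Ioo (0 : ℝ≥0) 1, ⨆ n : ℕ,
          eLpNorm (fun ω => toE (Z β Δt n ω)) (p : ℝ≥0∞) P) < ⊤ := by
  have hH14 : 1 / 4 < H := by rcases hH with h | h <;> linarith [h.1]
  have hH1 : H ≤ 1 := by rcases hH with h | h <;> linarith [h.2]
  have hH0 : 0 < H := by linarith
  refine ⟨fun Δt hΔ n => ⟨?_, ?_, ?_⟩, fun p _ => ?_⟩
  · filter_upwards [ae_summable_coefZ hH0 hβ hΔ.1 n] with ω hω
    exact ⟨hω.2.1, hω.2.2 ▸ inE_embed _⟩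
  · exact (embed.continuous.comp_aestronglyMeasurable
      (aestronglyMeasurable_contZ hH0 hβ hΔ.1 n)).congr
      ((ae_summable_coefZ hH0 hβ hΔ.1 n).mono fun ω hω => hω.2.2.symm)
  · exact (aestronglyMeasurable_contZ hH0 hβ hΔ.1 n).congr (ae_toE_eq hH0 hβ hΔ.1 n).symm
  · obtain ⟨C, hC, hb⟩ := exists_eLpNorm_contZ_le hH14 hH1 hβ hindep p
    refine ENNReal.add_lt_top.2 ⟨lt_of_le_of_lt ?_ hC, lt_of_le_of_lt ?_ hC⟩
    · refine iSup₂_le fun Δt hΔ => iSup_le fun n => (eLpNorm_mono_ae ?_).trans (hb Δt hΔ.1 n)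
      filter_upwards [ae_summable_coefZ hH0 hβ hΔ.1 n] with ω hω
      rw [hω.2.2]
      exact norm_embed_le _
    · refine iSup₂_le fun Δt hΔ => iSup_le fun n => ?_
      rw [eLpNorm_congr_ae (ae_toE_eq hH0 hβ hΔ.1 n)]
      exact hb Δt hΔ.1 n
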